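/- For a real matrix $M$ write $\|M\|_{\max}=\max_{i,j}|M_{ij}|$ and $\|M\|_F=(\sum_{i,j}M_{ij}^2)^{1/2}$. A matrix $U\in\mathbb{R}^{p\times r}$ with orthonormal columns ($U^\top U=I_r$) is called $\mu$-incoherent if each of its rows has Euclidean norm at most $\sqrt{\mu r/p}$. There is an absolute constant $\tilde c>0$ such that the following hold for all natural numbers $p,q,r$ and all real $\mu$. (i) Square matrices. Let $P=U\Sigma V^\top$ and $Q=L\Lambda R^\top$ be singular value decompositions of two distinct matrices $P,Q\in\mathbb{R}^{p\times p}$, where $U,V,L,R\in\mathbb{R}^{p\times r}$ have orthonormal columns and $\Sigma=\mathrm{diag}(\sigma_1,\dots,\sigma_r)$, $\Lambda=\mathrm{diag}(\lambda_1,\dots,\lambda_r)$ with $\sigma_1\ge\dots\ge\sigma_r\ge0$ and $\lambda_1\ge\dots\ge\lambda_r\ge0$. If $U,V,L,R$ are all $\mu$-incoherent, then $\Delta=P-Q$ satisfies $$\frac{\|\Delta\|_{\max}^2}{\|\Delta\|_F^2}\le\frac{\tilde c\,\mu\,r^4}{p}.$$ (ii) Rectangular matrices. Let $P=U\Sigma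 V^\top$ and $Q=L\Lambda R^\top$ be singular value decompositions of two distinct matrices $P,Q\in\mathbb{R}^{p\times q}$, where $U,L\in\mathbb{R}^{p\times r}$ and $V,R\in\mathbb{R}^{q\times r}$ have orthonormal columns and $\Sigma,\Lambda$ are as in (i), and let $\Delta=P-Q$. (a) If every row of $U,V,L,R$ has Euclidean norm at most $\sqrt{\mu r/\max\{p,q\}}$ (that is, the four factors are $\mu$-incoherent after being padded with zero rows to $\max\{p,q\}$ rows), then $$\frac{\|\Delta\|_{\max}^2}{\|\Delta\|_F^2}\le\frac{\tilde c\,\mu\,r^4}{\max\{p,q\}}.$$ (b) If $U,V,L,R$ are $\mu$-incoherent, each relative to its own number of rows, then $$\frac{\|\Delta\|_{\max}^2}{\|\Delta\|_F^2}\le\frac{\tilde c\,\mu\,r^4}{\min\{p,q\}}.$$ -/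

import Mathlib

open scoped Matrix

noncomputable section

/-- The Frobenius norm of a real matrix. -/
def frobNorm {p q : ℕ} (M : Matrix (Fin p) (Fin q) ℝ) : ℝ :=
  letI := Matrix.frobeniusSeminormedAddCommGroup (m := Fin p) (n := Fin q) (α := ℝ)
  ‖M‖

/-- The entrywise sup norm of a real matrix. -/
def maxNorm {p q : ℕ} (M : Matrix (Fin p) (Fin q) ℝ) : ℝ :=
  letI := Matrix.seminormedAddCommGroup (m := Fin p) (n := Fin q) (α := ℝ)
  ‖M‖

/-- The two-to-infinity norm: the largest Euclidean norm of a row. -/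
def twoInftyNorm {p r : ℕ} (U : Matrix (Fin p) (Fin r) ℝ) : ℝ :=
  ⨆ i, ‖WithLp.toLp 2 (U i)‖

/-- The columns of `U` are orthonormal. -/
def HasOrthonormalColumns {p r : ℕ} (U : Matrix (Fin p) (Fin r) ℝ) : Prop :=
  Uᵀ * U = 1

/-- `U` has orthonormal columns and rows of Euclidean norm at most `√(μ r / n)`, where `r` is the
number of columns of `U`. -/
def IsIncoherentRel {p r : ℕ} (n : ℕ) (μ : ℝ) (U : Matrix (Fin p) (Fin r) ℝ) : Prop :=
  HasOrthonormalColumns U ∧ twoInftyNorm U ≤ √(μ * r / n)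

/-- `μ`-incoherence of a `p × r` matrix with orthonormal columns: `‖U‖_{2,∞} ≤ √(μ r / p)`. -/
def IsIncoherent {p r : ℕ} (μ : ℝ) (U : Matrix (Fin p) (Fin r) ℝ) : Prop :=
  IsIncoherentRel p μ U

/-- `M = U diag(σ) Vᵀ` is a thin singular value decomposition with `r` singular values
`σ₁ ≥ ⋯ ≥ σᵣ ≥ 0`. -/
structure IsThinSVD {p q r : ℕ} (M : Matrix (Fin p) (Fin q) ℝ)
    (U : Matrix (Fin p) (Fin r) ℝ) (σ : Fin r → ℝ) (V : Matrix (Fin q) (Fin r) ℝ) : Prop where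
  left_orthonormal : HasOrthonormalColumns U
  right_orthonormal : HasOrthonormalColumns V
  antitone : Antitone σ
  nonneg : ∀ i, 0 ≤ σ i
  eq_mul : M = U * Matrix.diagonal σ * Vᵀ

theorem frobNorm_sq {p q : ℕ} (M : Matrix (Fin p) (Fin q) ℝ) :
    frobNorm M ^ 2 = ∑ i, ∑ j, M i j ^ 2 := by
  have h : 0 ≤ ∑ i, ∑ j, M i j ^ 2 :=
    Finset.sum_nonneg fun i _ => Finset.sum_nonneg fun j _ => sq_nonneg _
  have e : frobNorm M = √(∑ i, ∑ j, M i j ^ 2) := by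
    unfold frobNorm
    rw [Matrix.frobenius_norm_def, Real.sqrt_eq_rpow]
    simp
  rw [e, Real.sq_sqrt h]

theorem maxNorm_le_iff {p q : ℕ} (M : Matrix (Fin p) (Fin q) ℝ) {a : ℝ} (ha : 0 ≤ a) :
    maxNorm M ≤ a ↔ ∀ i j, |M i j| ≤ a :=
  Matrix.norm_le_iff ha

theorem twoInftyNorm_le_iff {p r : ℕ} (U : Matrix (Fin p) (Fin r) ℝ) {a : ℝ} (ha : 0 ≤ a) :
    twoInftyNorm U ≤ a ↔ ∀ i, √(∑ j, U i j ^ 2) ≤ a := by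
  have e : ∀ i, ‖WithLp.toLp 2 (U i)‖ = √(∑ j, U i j ^ 2) := fun i => by
    simp [EuclideanSpace.norm_eq]
  simp only [← e]
  exact ⟨fun h i => (le_ciSup (Set.finite_range _).bddAbove i).trans h,
    fun h => Real.iSup_le h ha⟩

end

/-! Put D = P - Q. Since U Uᵀ fixes P, the remainder N = (1 - U Uᵀ) D equals -(1 - U Uᵀ) Q, whose
rows lie in the column space of R. Hence D = U (Uᵀ D) + (N R) Rᵀ, and by Pythagoras the two
coefficient matrices have squared Frobenius norms adding up to that of D. Cauchy–Schwarz against the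
short rows of U and R bounds the entries of each summand. No spectral gap enters, and the bound is
linear in r; r⁴ is slack. -/

theorem frobNorm_sq_eq_trace {p q : ℕ} (M : Matrix (Fin p) (Fin q) ℝ) :
    frobNorm M ^ 2 = (Mᵀ * M).trace := by
  rw [frobNorm_sq, Finset.sum_comm]
  simp [Matrix.trace, Matrix.mul_apply, sq]

/-- Pythagoras for the orthogonal projection U Uᵀ: the cross terms and the projected term all have
the Gram matrix of Uᵀ M. -/
theorem frobNorm_sq_transpose_mul_add {p q r : ℕ} {U : Matrix (Fin p) (Fin r) ℝ}
    (hU : HasOrthonormalColumns U) (M : Matrix (Fin p) (Fin q) ℝ) :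
    frobNorm (Uᵀ * M) ^ 2 + frobNorm (M - U * (Uᵀ * M)) ^ 2 = frobNorm M ^ 2 := by
  have h : ((U * (Uᵀ * M))ᵀ * (U * (Uᵀ * M))) = (Uᵀ * M)ᵀ * (Uᵀ * M) := by
    rw [Matrix.transpose_mul, Matrix.mul_assoc, ← Matrix.mul_assoc Uᵀ U, hU, Matrix.one_mul]
  have h₁ : Mᵀ * (U * (Uᵀ * M)) = (Uᵀ * M)ᵀ * (Uᵀ * M) := by
    simp [Matrix.transpose_mul, Matrix.mul_assoc]
  have h₂ : (U * (Uᵀ * M))ᵀ * M = (Uᵀ * M)ᵀ * (Uᵀ * M) := by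
    simp [Matrix.transpose_mul, Matrix.mul_assoc]
  simp only [frobNorm_sq_eq_trace]
  rw [Matrix.transpose_sub, Matrix.sub_mul, Matrix.mul_sub, Matrix.mul_sub, h, h₁, h₂]
  simp

theorem frobNorm_sq_mul_of_mul_mul_transpose {p q r : ℕ} {N : Matrix (Fin p) (Fin q) ℝ}
    {R : Matrix (Fin q) (Fin r) ℝ} (h : N * R * Rᵀ = N) :
    frobNorm (N * R) ^ 2 = frobNorm N ^ 2 := by
  rw [frobNorm_sq_eq_trace, frobNorm_sq_eq_trace, Matrix.transpose_mul, Matrix.mul_assoc,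
    Matrix.trace_mul_comm, Matrix.mul_assoc, h]

theorem sum_sq_row_le_frobNorm_sq {p q : ℕ} (M : Matrix (Fin p) (Fin q) ℝ) (i : Fin p) :
    ∑ j, M i j ^ 2 ≤ frobNorm M ^ 2 := by
  rw [frobNorm_sq]
  exact Finset.single_le_sum (f := fun i => ∑ j, M i j ^ 2)
    (fun i _ => Finset.sum_nonneg fun j _ => sq_nonneg _) (Finset.mem_univ i)

theorem sum_sq_col_le_frobNorm_sq {p q : ℕ} (M : Matrix (Fin p) (Fin q) ℝ) (j : Fin q) :
    ∑ i, M i j ^ 2 ≤ frobNorm M ^ 2 := by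
  rw [frobNorm_sq, Finset.sum_comm]
  exact Finset.single_le_sum (f := fun j => ∑ i, M i j ^ 2)
    (fun j _ => Finset.sum_nonneg fun i _ => sq_nonneg _) (Finset.mem_univ j)

theorem sum_sq_row_le_of_twoInftyNorm_le {p r : ℕ} {U : Matrix (Fin p) (Fin r) ℝ} {a : ℝ}
    (ha : 0 ≤ a) (h : twoInftyNorm U ≤ a) (i : Fin p) : ∑ j, U i j ^ 2 ≤ a ^ 2 :=
  (Real.sqrt_le_left ha).1 ((twoInftyNorm_le_iff U ha).1 h i)

theorem mul_apply_sq_le {p q r : ℕ} {U : Matrix (Fin p) (Fin r) ℝ} {a : ℝ} (ha : 0 ≤ a)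
    (h : twoInftyNorm U ≤ a) (W : Matrix (Fin r) (Fin q) ℝ) (i : Fin p) (j : Fin q) :
    (U * W) i j ^ 2 ≤ a ^ 2 * frobNorm W ^ 2 := by
  rw [Matrix.mul_apply]
  exact (Finset.sum_mul_sq_le_sq_mul_sq _ _ _).trans
    (mul_le_mul (sum_sq_row_le_of_twoInftyNorm_le ha h i) (sum_sq_col_le_frobNorm_sq W j)
      (Finset.sum_nonneg fun _ _ => sq_nonneg _) (sq_nonneg a))

theorem mul_transpose_apply_sq_le {p q r : ℕ} {R : Matrix (Fin q) (Fin r) ℝ} {a : ℝ}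
    (ha : 0 ≤ a) (h : twoInftyNorm R ≤ a) (W : Matrix (Fin p) (Fin r) ℝ) (i : Fin p)
    (j : Fin q) : (W * Rᵀ) i j ^ 2 ≤ a ^ 2 * frobNorm W ^ 2 := by
  rw [Matrix.mul_apply, mul_comm (a ^ 2)]
  exact (Finset.sum_mul_sq_le_sq_mul_sq _ _ _).trans
    (mul_le_mul (sum_sq_row_le_frobNorm_sq W i) (sum_sq_row_le_of_twoInftyNorm_le ha h j)
      (Finset.sum_nonneg fun _ _ => sq_nonneg _) (sq_nonneg _))

/-- If the left factor of `P` and the right factor of `Q` have orthonormal columns and rows of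
norm at most `a`, the entries of `P - Q` are at most `√2 a` times its Frobenius norm: the part
of `P - Q` orthogonal to the column space of `P` has its row space in that of `Q`. -/
theorem maxNorm_sub_sq_le {p q r : ℕ} {P Q : Matrix (Fin p) (Fin q) ℝ}
    {U L : Matrix (Fin p) (Fin r) ℝ} {V R : Matrix (Fin q) (Fin r) ℝ} {σ τ : Fin r → ℝ} {a : ℝ}
    (hP : IsThinSVD P U σ V) (hQ : IsThinSVD Q L τ R) (ha : 0 ≤ a)
    (hU : twoInftyNorm U ≤ a) (hR : twoInftyNorm R ≤ a) :
    maxNorm (P - Q) ^ 2 ≤ 2 * a ^ 2 * frobNorm (P - Q) ^ 2 := by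
  have hUP : U * (Uᵀ * P) = P := by
    have h : Uᵀ * U = 1 := hP.left_orthonormal
    rw [hP.eq_mul, Matrix.mul_assoc U, ← Matrix.mul_assoc Uᵀ, h, Matrix.one_mul]
  have hQR : Q * R * Rᵀ = Q := by
    have h : Rᵀ * R = 1 := hQ.right_orthonormal
    rw [hQ.eq_mul, Matrix.mul_assoc _ Rᵀ R, h, Matrix.mul_one]
  set D := P - Q with hD
  set N := D - U * (Uᵀ * D) with hN
  have hNQ : N = U * (Uᵀ * Q) - Q := by
    rw [hN, hD, Matrix.mul_sub, Matrix.mul_sub, hUP]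
    abel
  -- Left multiplication by 1 - U Uᵀ preserves Q R Rᵀ = Q.
  have hNR : N * R * Rᵀ = N := by
    rw [hNQ, Matrix.sub_mul, Matrix.sub_mul, hQR]
    simp only [Matrix.mul_assoc] at hQR ⊢
    rw [hQR]
  have hsum := frobNorm_sq_transpose_mul_add hP.left_orthonormal D
  rw [← hN, ← frobNorm_sq_mul_of_mul_mul_transpose hNR] at hsum
  have hsplit : D = U * (Uᵀ * D) + N * R * Rᵀ := by rw [hNR, hN]; abel
  have hentry : ∀ i j, D i j ^ 2 ≤ 2 * a ^ 2 * frobNorm D ^ 2 := fun i j => by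
    have h₁ := mul_apply_sq_le ha hU (Uᵀ * D) i j
    have h₂ := mul_transpose_apply_sq_le ha hR (N * R) i j
    have h₃ : D i j = (U * (Uᵀ * D)) i j + (N * R * Rᵀ) i j := congrFun₂ hsplit i j
    -- The constant 2 comes from (x + y)² ≤ 2 (x² + y²).
    have h₄ := add_sq_le (a := (U * (Uᵀ * D)) i j) (b := (N * R * Rᵀ) i j)
    rw [← h₃] at h₄
    rw [← hsum]
    linarith
  have hb : 0 ≤ 2 * a ^ 2 * frobNorm D ^ 2 := by positivity
  have hm : maxNorm D ≤ √(2 * a ^ 2 * frobNorm D ^ 2) :=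
    (maxNorm_le_iff D (Real.sqrt_nonneg _)).2 fun i j => Real.abs_le_sqrt (hentry i j)
  have hm₀ : 0 ≤ maxNorm D :=
    letI := Matrix.seminormedAddCommGroup (m := Fin p) (n := Fin q) (α := ℝ)
    norm_nonneg D
  calc maxNorm D ^ 2 ≤ √(2 * a ^ 2 * frobNorm D ^ 2) ^ 2 := by gcongr
    _ = _ := Real.sq_sqrt hb

theorem maxNorm_pos {p q : ℕ} {M : Matrix (Fin p) (Fin q) ℝ} (h : M ≠ 0) : 0 < maxNorm M := by
  by_contra! hM
  refine h (Matrix.ext fun i j => ?_)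
  simpa using (maxNorm_le_iff M le_rfl).1 hM i j

theorem maxNorm_sub_sq_div_le {p q r n : ℕ} {μ : ℝ} {P Q : Matrix (Fin p) (Fin q) ℝ}
    {U L : Matrix (Fin p) (Fin r) ℝ} {V R : Matrix (Fin q) (Fin r) ℝ} {σ τ : Fin r → ℝ}
    (hP : IsThinSVD P U σ V) (hQ : IsThinSVD Q L τ R)
    (hU : twoInftyNorm U ≤ √(μ * r / n)) (hR : twoInftyNorm R ≤ √(μ * r / n)) (hne : P ≠ Q) :
    maxNorm (P - Q) ^ 2 / frobNorm (P - Q) ^ 2 ≤ 2 * μ * (r : ℝ) ^ 4 / n := by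
  have hmain := maxNorm_sub_sq_le hP hQ (Real.sqrt_nonneg _) hU hR
  have hpos : 0 < maxNorm (P - Q) ^ 2 := pow_pos (maxNorm_pos (sub_ne_zero.2 hne)) 2
  -- Otherwise the root is 0 and the bound forces P = Q. This disposes of μ ≤ 0, r = 0 and n = 0
  -- (where division gives 0).
  have hx : 0 < μ * r / n := by
    by_contra! hx
    rw [Real.sqrt_eq_zero_of_nonpos hx] at hmain
    linarith
  rw [Real.sq_sqrt hx.le] at hmain
  have hr : 1 ≤ r := Nat.one_le_iff_ne_zero.2 fun h => by simp [h] at hx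
  have hr' : (1 : ℝ) ≤ (r : ℝ) ^ 3 := one_le_pow₀ (by exact_mod_cast hr)
  calc maxNorm (P - Q) ^ 2 / frobNorm (P - Q) ^ 2 ≤ 2 * (μ * r / n) :=
        div_le_of_le_mul₀ (sq_nonneg _) (by positivity) hmain
    _ ≤ 2 * (μ * r / n) * (r : ℝ) ^ 3 := le_mul_of_one_le_right (by positivity) hr'
    _ = 2 * μ * (r : ℝ) ^ 4 / n := by ring

/-- Splitting the root first makes the sign of x irrelevant, as √x = 0 for x < 0. -/
theorem sqrt_div_natCast_le {x : ℝ} {m n : ℕ} (hm : 0 < m) (h : m ≤ n) :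
    √(x / n) ≤ √(x / m) := by
  rw [Real.sqrt_div' _ n.cast_nonneg, Real.sqrt_div' _ m.cast_nonneg]
  gcongr

theorem mainTheorem2 :
    ∃ c : ℝ, 0 < c ∧
      -- square matrices
      (∀ (p r : ℕ) (μ : ℝ) (P Q : Matrix (Fin p) (Fin p) ℝ)
        (U V L R : Matrix (Fin p) (Fin r) ℝ) (σ τ : Fin r → ℝ),
        IsThinSVD P U σ V → IsThinSVD Q L τ R →
        IsIncoherent μ U → IsIncoherent μ V → IsIncoherent μ L → IsIncoherent μ R →
        P ≠ Q →
        maxNorm (P - Q) ^ 2 / frobNorm (P - Q) ^ 2 ≤ c * μ * (r : ℝ) ^ 4 / p) ∧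
      -- rectangular matrices, incoherence measured after zero-padding to size `max p q`
      (∀ (p q r : ℕ) (μ : ℝ) (P Q : Matrix (Fin p) (Fin q) ℝ)
        (U L : Matrix (Fin p) (Fin r) ℝ) (V R : Matrix (Fin q) (Fin r) ℝ) (σ τ : Fin r → ℝ),
        IsThinSVD P U σ V → IsThinSVD Q L τ R →
        IsIncoherentRel (max p q) μ U → IsIncoherentRel (max p q) μ V →
        IsIncoherentRel (max p q) μ L → IsIncoherentRel (max p q) μ R →
        P ≠ Q →
        maxNorm (P - Q) ^ 2 / frobNorm (P - Q) ^ 2 ≤ c * μ * (r : ℝ) ^ 4 / (max p q : ℕ)) ∧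
      -- rectangular matrices, each factor incoherent relative to its own number of rows
      (∀ (p q r : ℕ) (μ : ℝ) (P Q : Matrix (Fin p) (Fin q) ℝ)
        (U L : Matrix (Fin p) (Fin r) ℝ) (V R : Matrix (Fin q) (Fin r) ℝ) (σ τ : Fin r → ℝ),
        IsThinSVD P U σ V → IsThinSVD Q L τ R →
        IsIncoherent μ U → IsIncoherent μ V → IsIncoherent μ L → IsIncoherent μ R →
        P ≠ Q →
        maxNorm (P - Q) ^ 2 / frobNorm (P - Q) ^ 2 ≤ c * μ * (r : ℝ) ^ 4 / (min p q : ℕ)) := by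
  refine ⟨2, two_pos, ?_, ?_, ?_⟩
  · intro p r μ P Q U V L R σ τ hP hQ hU _ _ hR hne
    exact maxNorm_sub_sq_div_le hP hQ hU.2 hR.2 hne
  · intro p q r μ P Q U L V R σ τ hP hQ hU _ _ hR hne
    exact maxNorm_sub_sq_div_le hP hQ hU.2 hR.2 hne
  · intro p q r μ P Q U L V R σ τ hP hQ hU _ _ hR hne
    -- An empty matrix type has only one element, contradicting P ≠ Q.
    have hmin : 0 < min p q := by
      rw [lt_min_iff, Nat.pos_iff_ne_zero, Nat.pos_iff_ne_zero]
      constructor <;> rintro rfl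
      · exact hne (Matrix.ext fun i => i.elim0)
      · exact hne (Matrix.ext fun _ j => j.elim0)
    exact maxNorm_sub_sq_div_le hP hQ
      (hU.2.trans (sqrt_div_natCast_le hmin (min_le_left p q)))
      (hR.2.trans (sqrt_div_natCast_le hmin (min_le_right p q))) hne
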